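/- Let $K$ be an algebraically closed field of characteristic $0$. A (not necessarily unital or associative) $K$-algebra is called assosymmetric if $(a,b,c)=(a,c,b)=(b,a,c)$ for all $a,b,c$, where $(a,b,c)=(ab)c-a(bc)$. For $n\ge 1$ let $F$ be the free (non-unital) assosymmetric $K$-algebra on $x_1,\dots,x_n$, and let $P_n\subseteq F$ be its multilinear part, i.e. the span of all bracketed monomials in which each of $x_1,\dots,x_n$ occurs exactly once. The symmetric group $S_n$ acts on $F$ by the algebra automorphisms $x_i\mapsto x_{\sigma(i)}$, and $P_n$ is stable under this action. Write $[a,b]=ab-ba$. Let $KT_n\subseteq F$ be the span of $$T_n=\{(\cdots((x_{\sigma(1)}x_{\sigma(2)})x_{\sigma(3)})\cdots)x_{\sigma(n)} \mid \sigma\in S_n\},$$ and for $0\le k\le n-3$ let $KT_{k,n-k}\subseteq F$ be the span of the set $T_{k,n-k}$ of the elements $$x_{\sigma(1)}(x_{\sigma(2)}(\cdots (x_{\sigma(k)}[\cdots[(x_{\sigma(k+1)},x_{\sigma(k+2)},x_{\sigma(k+3)}),x_{\sigma(k+4)}],\cdots,x_{\sigma(n)}])\cdots)),$$ where $\sigma\in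 S_n$, $\sigma(1)<\cdots<\sigma(k)$ and $\sigma(k+1)<\cdots<\sigma(n)$. Then $KT_n$ and all $KT_{k,n-k}$ are $S_n$-submodules of $P_n$, and $P_n$ is their internal direct sum; in particular, as $S_n$-modules, $$P_n\cong KT_n\oplus\bigoplus_{k=0}^{n-3}KT_{k,n-k}.$$ (For $n\le 2$ the second sum is empty.) -/

import Mathlib

noncomputable section

namespace Assosymmetric

/-- The verbal ideal (T-ideal) of assosymmetric algebras in the absolutely free nonassociative
algebra `K{X}`: the smallest two-sided ideal containing all values of the polynomials
`(a, b, c) - (a, c, b)` and `(a, b, c) - (b, a, c)`, where `associator a b c = (a b) c - a (b c)`. -/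
def verbalIdeal (K X : Type*) [Field K] : Submodule K (FreeNonUnitalNonAssocAlgebra K X) :=
  sInf {I | (∀ a b c, associator a b c - associator a c b ∈ I) ∧
    (∀ a b c, associator a b c - associator b a c ∈ I) ∧
    ∀ a, ∀ x ∈ I, a * x ∈ I ∧ x * a ∈ I}

theorem verbalIdeal_right {K X : Type*} [Field K] (a b c : FreeNonUnitalNonAssocAlgebra K X) :
    associator a b c - associator a c b ∈ verbalIdeal K X :=
  Submodule.mem_sInf.2 fun _ hI => hI.1 a b c

theorem verbalIdeal_left {K X : Type*} [Field K] (a b c : FreeNonUnitalNonAssocAlgebra K X) :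
    associator a b c - associator b a c ∈ verbalIdeal K X :=
  Submodule.mem_sInf.2 fun _ hI => hI.2.1 a b c

theorem verbalIdeal_mul_mem {K X : Type*} [Field K] (a : FreeNonUnitalNonAssocAlgebra K X)
    {x : FreeNonUnitalNonAssocAlgebra K X} (hx : x ∈ verbalIdeal K X) :
    a * x ∈ verbalIdeal K X :=
  Submodule.mem_sInf.2 fun I hI => (hI.2.2 a x (Submodule.mem_sInf.1 hx I hI)).1

theorem verbalIdeal_mem_mul {K X : Type*} [Field K] (a : FreeNonUnitalNonAssocAlgebra K X)
    {x : FreeNonUnitalNonAssocAlgebra K X} (hx : x ∈ verbalIdeal K X) :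
    x * a ∈ verbalIdeal K X :=
  Submodule.mem_sInf.2 fun I hI => (hI.2.2 a x (Submodule.mem_sInf.1 hx I hI)).2

/-- The free assosymmetric algebra `F(X)` on the set `X` (without unit). -/
def FreeAssosymmetric (K X : Type*) [Field K] : Type _ :=
  FreeNonUnitalNonAssocAlgebra K X ⧸ verbalIdeal K X

variable {K X Y : Type*} [Field K]

instance : AddCommGroup (FreeAssosymmetric K X) :=
  inferInstanceAs (AddCommGroup (FreeNonUnitalNonAssocAlgebra K X ⧸ verbalIdeal K X))

instance : Module K (FreeAssosymmetric K X) :=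
  inferInstanceAs (Module K (FreeNonUnitalNonAssocAlgebra K X ⧸ verbalIdeal K X))

/-- The quotient map `K{X} → F(X)`. -/
def proj (K X : Type*) [Field K] : FreeNonUnitalNonAssocAlgebra K X →ₗ[K] FreeAssosymmetric K X :=
  (verbalIdeal K X).mkQ

theorem proj_surjective : Function.Surjective (proj K X) :=
  (verbalIdeal K X).mkQ_surjective

theorem proj_eq_iff {a b : FreeNonUnitalNonAssocAlgebra K X} :
    proj K X a = proj K X b ↔ a - b ∈ verbalIdeal K X :=
  Submodule.Quotient.eq (verbalIdeal K X)

/-- The multiplication of `F(X)`, induced from the one of `K{X}`. -/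
instance : Mul (FreeAssosymmetric K X) where
  mul := Quotient.map₂ (· * ·) (by
    intro a b hab c d hcd
    have h1 : a - b ∈ verbalIdeal K X := (Submodule.quotientRel_def _).1 hab
    have h2 : c - d ∈ verbalIdeal K X := (Submodule.quotientRel_def _).1 hcd
    refine (Submodule.quotientRel_def _).2 ?_
    have h : a * c - b * d = (a - b) * c + b * (c - d) := by
      rw [sub_mul, mul_sub]; abel
    rw [h]
    exact add_mem (verbalIdeal_mem_mul c h1) (verbalIdeal_mul_mem b h2))

theorem proj_mul (a b : FreeNonUnitalNonAssocAlgebra K X) :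
    proj K X (a * b) = proj K X a * proj K X b := rfl

instance : NonUnitalNonAssocRing (FreeAssosymmetric K X) where
  left_distrib a b c := by
    obtain ⟨a, rfl⟩ := proj_surjective a
    obtain ⟨b, rfl⟩ := proj_surjective b
    obtain ⟨c, rfl⟩ := proj_surjective c
    simp only [← map_add, ← proj_mul, mul_add]
  right_distrib a b c := by
    obtain ⟨a, rfl⟩ := proj_surjective a
    obtain ⟨b, rfl⟩ := proj_surjective b
    obtain ⟨c, rfl⟩ := proj_surjective c
    simp only [← map_add, ← proj_mul, add_mul]
  zero_mul a := by
    obtain ⟨a, rfl⟩ := proj_surjective a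
    rw [← map_zero (proj K X), ← proj_mul, zero_mul]
  mul_zero a := by
    obtain ⟨a, rfl⟩ := proj_surjective a
    rw [← map_zero (proj K X), ← proj_mul, mul_zero]

instance : IsScalarTower K (FreeAssosymmetric K X) (FreeAssosymmetric K X) where
  smul_assoc r a b := by
    obtain ⟨a, rfl⟩ := proj_surjective a
    obtain ⟨b, rfl⟩ := proj_surjective b
    simp only [smul_eq_mul, ← map_smul, ← proj_mul, smul_mul_assoc]

instance : SMulCommClass K (FreeAssosymmetric K X) (FreeAssosymmetric K X) where
  smul_comm r a b := by
    obtain ⟨a, rfl⟩ := proj_surjective a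
    obtain ⟨b, rfl⟩ := proj_surjective b
    simp only [smul_eq_mul, ← map_smul, ← proj_mul, mul_smul_comm]

/-- The monomial of `F(X)` given by a bracketed word. -/
def monomial (K : Type*) {X : Type*} [Field K] (w : FreeMagma X) : FreeAssosymmetric K X :=
  proj K X (MonoidAlgebra.ofMagma K (FreeMagma X) w)

/-- The free generator `x_i` of `F(X)`. -/
def gen (K : Type*) {X : Type*} [Field K] (i : X) : FreeAssosymmetric K X :=
  monomial K (FreeMagma.of i)

/-- The endomorphism of `K{X}` (more generally, the map `K{X} → K{Y}`) that renames variables. -/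
def renameFree (K : Type*) {X Y : Type*} [Field K] (f : X → Y) :
    FreeNonUnitalNonAssocAlgebra K X →ₙₐ[K] FreeNonUnitalNonAssocAlgebra K Y :=
  FreeNonUnitalNonAssocAlgebra.lift K fun x => FreeNonUnitalNonAssocAlgebra.of K (f x)

theorem renameFree_mem (f : X → Y) :
    verbalIdeal K X ≤ (verbalIdeal K Y).comap
      (renameFree K f : FreeNonUnitalNonAssocAlgebra K X →ₗ[K] FreeNonUnitalNonAssocAlgebra K Y) := by
  refine sInf_le ⟨fun a b c => ?_, fun a b c => ?_, fun a x hx => ⟨?_, ?_⟩⟩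
  · simpa [associator] using!
      verbalIdeal_right (renameFree K f a) (renameFree K f b) (renameFree K f c)
  · simpa [associator] using!
      verbalIdeal_left (renameFree K f a) (renameFree K f b) (renameFree K f c)
  · simpa using! verbalIdeal_mul_mem (renameFree K f a) hx
  · simpa using! verbalIdeal_mem_mul (renameFree K f a) hx

/-- The linear map `F(X) → F(Y)` that renames variables, `x_i ↦ y_{f i}`. -/
def rename (K : Type*) {X Y : Type*} [Field K] (f : X → Y) :
    FreeAssosymmetric K X →ₗ[K] FreeAssosymmetric K Y :=
  Submodule.mapQ (verbalIdeal K X) (verbalIdeal K Y)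
    (renameFree K f : FreeNonUnitalNonAssocAlgebra K X →ₗ[K] FreeNonUnitalNonAssocAlgebra K Y)
    (renameFree_mem f)

theorem rename_proj (f : X → Y) (a : FreeNonUnitalNonAssocAlgebra K X) :
    rename K f (proj K X a) = proj K Y (renameFree K f a) := rfl

theorem renameFree_word (f : X → Y) (w : FreeMagma X) :
    renameFree K f (MonoidAlgebra.ofMagma K (FreeMagma X) w) =
      MonoidAlgebra.ofMagma K (FreeMagma Y) (FreeMagma.map f w) := by
  induction w using FreeMagma.recOnMul with
  | ih1 x => exact FreeNonUnitalNonAssocAlgebra.lift_of_apply K _ x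
  | ih2 a b ha hb => rw [map_mul, map_mul, ha, hb, map_mul, map_mul]

theorem rename_monomial (f : X → Y) (w : FreeMagma X) :
    rename K f (monomial K w) = monomial K (FreeMagma.map f w) := by
  rw [monomial, rename_proj, renameFree_word, monomial]

/-- The action of `S_n` on the free assosymmetric algebra in `n` generators by permuting the
variables: `σ` acts by the algebra automorphism with `x_i ↦ x_{σ i}`. -/
def variableAction (K : Type*) [Field K] (n : ℕ) :
    Representation K (Equiv.Perm (Fin n)) (FreeAssosymmetric K (Fin n)) where
  toFun σ := rename K σ
  map_one' := by
    have h : renameFree K ((1 : Equiv.Perm (Fin n)) : Fin n → Fin n) =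
        NonUnitalAlgHom.id K _ :=
      FreeNonUnitalNonAssocAlgebra.hom_ext K fun x => by simp [renameFree]
    ext a
    obtain ⟨a, rfl⟩ := proj_surjective a
    rw [rename_proj, h]
    rfl
  map_mul' σ τ := by
    have h : renameFree K ((σ * τ : Equiv.Perm (Fin n)) : Fin n → Fin n) =
        (renameFree K σ).comp (renameFree K τ) :=
      FreeNonUnitalNonAssocAlgebra.hom_ext K fun x => by simp [renameFree]
    ext a
    obtain ⟨a, rfl⟩ := proj_surjective a
    rw [rename_proj, h]
    rfl

/-- The multidegree of a bracketed word: the multiset of its letters. -/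
def multidegree {X : Type*} : FreeMagma X → Multiset X
  | FreeMagma.of x => {x}
  | FreeMagma.mul a b => multidegree a + multidegree b

theorem multidegree_map (f : X → Y) (w : FreeMagma X) :
    multidegree (FreeMagma.map f w) = (multidegree w).map f := by
  induction w using FreeMagma.recOnMul with
  | ih1 x => exact (Multiset.map_singleton f x).symm
  | ih2 a b ha hb =>
    rw [map_mul]
    change multidegree _ + multidegree _ = Multiset.map f (multidegree a + multidegree b)
    rw [ha, hb, Multiset.map_add]

/-- The multilinear part `P_n` of the free assosymmetric algebra in `n` generators, as an
`S_n`-module: the span of the monomials in which every generator occurs exactly once. -/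
def multilinearPart (K : Type*) [Field K] (n : ℕ) : Subrepresentation (variableAction K n) where
  toSubmodule := Submodule.span K
    (monomial K '' {w : FreeMagma (Fin n) | multidegree w = (Finset.univ : Finset (Fin n)).val})
  apply_mem_toSubmodule σ v hv := by
    induction hv using Submodule.span_induction with
    | mem x hx =>
      obtain ⟨w, hw, rfl⟩ := hx
      refine Submodule.subset_span ⟨FreeMagma.map σ w, ?_, (rename_monomial _ w).symm⟩
      rw [Set.mem_ofPred_eq, multidegree_map, hw]
      exact congrArg Finset.val (Finset.map_univ_equiv σ)
    | zero => rw [map_zero]; exact zero_mem _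
    | add x y _ _ hx hy => rw [map_add]; exact add_mem hx hy
    | smul c x _ hx => rw [map_smul]; exact Submodule.smul_mem _ c hx

/-- The left-normed product `(...((a₁ a₂) a₃) ...) a_m` (of a nonempty list). -/
def leftNormed {A : Type*} [NonUnitalNonAssocRing A] : List A → A
  | a :: l => l.foldl (fun u v => u * v) a
  | _ => 0

/-- `[...[[(a₁, a₂, a₃), a₄], a₅], ..., a_m]` (of a list of length at least three), where
`[u, v] = u v - v u`. -/
def commutatorOfAssociator {A : Type*} [NonUnitalNonAssocRing A] : List A → A
  | a :: b :: c :: l => l.foldl (fun u v => u * v - v * u) (associator a b c)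
  | _ => 0

/-- The list `x_{σ(1)}, ..., x_{σ(n)}`. -/
def letters (K : Type*) [Field K] {n : ℕ} (σ : Equiv.Perm (Fin n)) :
    List (FreeAssosymmetric K (Fin n)) :=
  List.ofFn fun i => gen K (σ i)

/-- The set `T_n` of basis elements of the first type. -/
def firstType (K : Type*) [Field K] (n : ℕ) : Set (FreeAssosymmetric K (Fin n)) :=
  {u | ∃ σ : Equiv.Perm (Fin n), u = leftNormed (letters K σ)}

/-- The set `T_{k, n-k}` of basis elements of the second type
`x_{σ(1)} (x_{σ(2)} (... x_{σ(k)} [...[(x_{σ(k+1)}, x_{σ(k+2)}, x_{σ(k+3)}), x_{σ(k+4)}], ...,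
x_{σ(n)}] ...))` with `σ(1) < ... < σ(k)` and `σ(k+1) < ... < σ(n)` (positions in `Fin n` are
counted from `0`). -/
def secondType (K : Type*) [Field K] (n k : ℕ) : Set (FreeAssosymmetric K (Fin n)) :=
  {u | ∃ σ : Equiv.Perm (Fin n),
    (∀ i j : Fin n, i < j → (j : ℕ) < k → σ i < σ j) ∧
    (∀ i j : Fin n, k ≤ (i : ℕ) → i < j → σ i < σ j) ∧
    u = ((letters K σ).take k).foldr (fun a v => a * v)
      (commutatorOfAssociator ((letters K σ).drop k))}

/-- `KT_n`, the span of the basis elements of the first type. -/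
def KT (K : Type*) [Field K] (n : ℕ) : Submodule K (FreeAssosymmetric K (Fin n)) :=
  Submodule.span K (firstType K n)

/-- `KT_{k, n-k}`, the span of the basis elements of the second type. -/
def KTk (K : Type*) [Field K] (n k : ℕ) : Submodule K (FreeAssosymmetric K (Fin n)) :=
  Submodule.span K (secondType K n k)

end Assosymmetric

end

noncomputable section

namespace Assosymmetric

/-! Spanning. The Teichmüller identity `associator_cocycle`, combined with symmetry of the
associator and absence of additive torsion, yields a product rule for associators (`associator_mul`)
and the full symmetry of `[(a,b,c),d]` (`commutator_associator_swap`). From these it follows that an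
associator `u` satisfies `(u,a,b) = 0` and gives zero when multiplied by any commutator or
associator (`isCentralizing_associator`). Elements with these properties are stable under
multiplication by arbitrary elements, and on them all left and right multiplications commute. Hence
an element of the second type depends only on which letters are outside and which are inside
(`nestedProduct_perm`), and associators of words are combinations of such elements
(`associator_monomial_mem`). The rebracketing `a(bc) = (ab)c - (a,b,c)` then reduces every word to
left-normed ones modulo the second type (`monomial_mem`).

Independence. Two models separate the elements. The free associative algebra kills the second type
and sends the left-normed products to distinct words. `TripleAlgebra` over a polynomial ring, a
non-associative assosymmetric algebra, sends the second type elements to distinct squarefree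
monomials. So both types together are independent (`linearIndependent_basisFamily`), and the
summands are spans of disjoint blocks of one independent family. Renaming variables preserves each
block's span. -/

/-- A nonassociative ring is assosymmetric if its associator is a symmetric function. -/
structure IsAssosymmetric (A : Type*) [NonUnitalNonAssocRing A] : Prop where
  right : ∀ a b c : A, associator a b c = associator a c b
  left : ∀ a b c : A, associator a b c = associator b a c

/-- The elements `u` on which left and right multiplications act as commuting families of
commuting operators, and which are annihilated by all associators. -/
structure IsCentralizing {A : Type*} [NonUnitalNonAssocRing A] (u : A) : Prop where
  associator_eq_zero : ∀ a b, associator u a b = 0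
  commutator_mul : ∀ a b, (a * b - b * a) * u = 0
  mul_commutator : ∀ a b, u * (a * b - b * a) = 0
  associator_mul : ∀ a b c, associator a b c * u = 0
  mul_associator : ∀ a b c, u * associator a b c = 0

/-! ### Identities of torsion-free assosymmetric rings. -/

namespace IsAssosymmetric

variable {A : Type*} [NonUnitalNonAssocRing A]

theorem rotate (h : IsAssosymmetric A) (a b c : A) : associator a b c = associator b c a := by
  rw [h.left, h.right]

theorem sub_associator (a b c d : A) :
    associator (a - b) c d = associator a c d - associator b c d := by
  simp only [associator_apply, sub_mul]
  abel

theorem add_associator (a b c d : A) :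
    associator (a + b) c d = associator a c d + associator b c d := by
  simp only [associator_apply, add_mul]
  abel

/-- The Teichmüller identity, with symmetry used to move each product into the first slot. -/
theorem cocycle (h : IsAssosymmetric A) (a b c d : A) :
    associator (a * b) c d - associator (b * c) a d + associator (c * d) a b =
      a * associator b c d + associator a b c * d := by
  have e := associator_cocycle a b c d
  rw [h.left a (b * c) d, ← h.rotate (c * d) a b] at e
  rw [← sub_eq_zero, ← neg_eq_zero, ← e]
  abel

/-- The defect `f` of the identity is symmetric in its last two arguments and changes sign under a
cyclic shift of all four. The shift followed by that transposition has order three, so applying it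
three times gives `f = -f`. -/
theorem associator_mul [IsAddTorsionFree A] (h : IsAssosymmetric A) (w x y z : A) :
    associator (w * x) y z = x * associator w y z + associator x y z * w := by
  let f (a b c d : A) : A := associator (a * b) c d - b * associator a c d - associator b c d * a
  have hs (a b c d : A) : f a b c d = f a b d c := by
    simp only [f, h.right (a * b) c d, h.right a c d, h.right b c d]
  have hc (a b c d : A) : f a b c d = -f d a b c := by
    -- In the sum of these two instances the associators containing `b * c` and `c * d` cancel.
    have e1 := h.cocycle a b c d
    have e2 := h.cocycle b c d a
    rw [h.right (b * c) d a, h.right (c * d) b a] at e2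
    simp only [f]
    rw [← h.rotate d b c, h.rotate a c d] at *
    linear_combination (norm := abel) e1 + e2
  have : f w x y z = 0 := self_eq_neg.1 (by
    conv_lhs => rw [hc, hs, hc, hs, hc, hs, neg_neg])
  simp only [f] at this
  rw [← sub_eq_zero, ← this]
  abel

/-- Expanding the cocycle identity by the product rule leaves an alternating sum of the four
commutators of one letter with the associator of the other three. Adding the instance with `b` and
`c` exchanged cancels two of them and doubles the other two. -/
theorem commutator_associator_swap [IsAddTorsionFree A] (h : IsAssosymmetric A) (a b c d : A) :
    associator a b c * d - d * associator a b c = associator d b c * a - a * associator d b c := by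
  have key (w x y z : A) := h.cocycle w x y z
  simp only [h.associator_mul] at key
  have e1 := key a d b c
  have e2 := key a d c b
  rw [← sub_eq_zero]
  refine self_eq_neg.1 ?_
  have hdcb : associator d c b = associator b c d := by rw [h.rotate, h.left]
  simp only [hdcb, h.right a c b, h.rotate c a b, h.rotate d b c,
    h.right a d b, h.rotate d a b, h.rotate d a c, h.right a d c, h.left b a d, h.left b a c,
      h.left c a d] at e1 e2 ⊢
  linear_combination (norm := abel) -e1 - e2

theorem associator_mul' [IsAddTorsionFree A] (h : IsAssosymmetric A) (w x y z : A) :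
    associator (w * x) y z = w * associator x y z + associator w y z * x := by
  rw [h.associator_mul]
  linear_combination (norm := abel) h.commutator_associator_swap x y z w

theorem associator_mul_comm [IsAddTorsionFree A] (h : IsAssosymmetric A) (w x y z : A) :
    associator (w * x) y z = associator (x * w) y z := by
  rw [h.associator_mul, h.associator_mul']

theorem associator_commutator [IsAddTorsionFree A] (h : IsAssosymmetric A) (a b c d : A) :
    associator (a * b - b * a) c d = 0 := by
  rw [sub_associator, h.associator_mul_comm, sub_self]

/-- The two product rules expand `((bc - cb)a, d, e)` in opposite orders, and the associator
containing the commutator drops out of both. -/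
theorem commutator_mul_comm [IsAddTorsionFree A] (h : IsAssosymmetric A) (a b c d e : A) :
    (b * c - c * b) * associator a d e = associator a d e * (b * c - c * b) := by
  have e1 := h.associator_mul (b * c - c * b) a d e
  rw [h.associator_mul', h.associator_commutator, mul_zero, zero_mul, zero_add, add_zero] at e1
  exact e1

/-- The failure of the Leibniz rule for commutators is a signed sum of three associators in general;
symmetry cancels two of them. -/
theorem commutator_mul_eq (h : IsAssosymmetric A) (a b c : A) :
    (a * b) * c - c * (a * b) =
      a * (b * c - c * b) + (a * c - c * a) * b + associator a b c := by
  have e := h.left a c b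
  simp only [associator_apply, mul_sub, sub_mul] at *
  linear_combination (norm := abel) -e

/-- Expands the vanishing associator `([ab, c], d, e)` by the defective Leibniz rule. -/
theorem associator_associator_add [IsAddTorsionFree A] (h : IsAssosymmetric A) (a b c d e : A) :
    associator a d e * (b * c - c * b) + associator b d e * (a * c - c * a) +
      associator (associator a b c) d e = 0 := by
  have e := h.associator_commutator (a * b) c d e
  rw [h.commutator_mul_eq, add_associator, add_associator, h.associator_mul,
    h.associator_mul' (a * c - c * a), h.associator_commutator, h.associator_commutator,
    h.commutator_mul_comm, h.commutator_mul_comm, zero_mul, zero_mul, add_zero, add_zero] at e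
  exact e

/-- In the cyclic sum over `a, b, c` of the previous identity the commutator terms cancel, leaving
three times the claim. -/
theorem associator_associator [IsAddTorsionFree A] (h : IsAssosymmetric A) (a b c d e : A) :
    associator (associator a b c) d e = 0 := by
  have e1 := h.associator_associator_add a b c d e
  have e2 := h.associator_associator_add b c a d e
  have e3 := h.associator_associator_add c a b d e
  rw [← h.rotate a b c] at e2
  rw [h.rotate c a b] at e3
  refine (nsmul_eq_zero_iff_right (n := 3) (by norm_num)).1 ?_
  simp only [mul_sub] at *
  linear_combination (norm := abel) e1 + e2 + e3

/-- The product is symmetric in `a, d` and antisymmetric in `a, b`. The two transpositions compose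
to a 3-cycle with sign `-1`, whose cube gives `g = -g`. -/
theorem associator_mul_commutator [IsAddTorsionFree A] (h : IsAssosymmetric A) (a b c d e : A) :
    associator a d e * (b * c - c * b) = 0 := by
  let g (a b c d e : A) : A := associator a d e * (b * c - c * b)
  have hs (a b c d e : A) : g a b c d e = g d b c a e := by
    simp only [g, h.left a d e]
  have hn (a b c d e : A) : g a b c d e = -g b a c d e := by
    have := h.associator_associator_add a b c d e
    rw [h.associator_associator, add_zero] at this
    exact eq_neg_of_add_eq_zero_left this
  refine self_eq_neg.1 (?_ : g a b c d e = -g a b c d e)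
  conv_lhs => rw [hs, hn, hs, hn, hs, hn, neg_neg]

theorem associator_mul_associator [IsAddTorsionFree A] (h : IsAssosymmetric A)
    (a b c d e f : A) : associator a b c * associator d e f = 0 := by
  let g (a b c d e f : A) : A := associator a b c * associator d e f
  have hs (a b c d e f : A) : g a b c d e f = g b a c d e f := by
    simp only [g, h.left a b c]
  have hn (a b c d e f : A) : g a b c d e f = -g d b c a e f := by
    -- Expanding the inner and then the outer associator leaves only the two products of
    -- associators.
    have := h.associator_associator (d * a) e f b c
    rw [h.associator_mul, add_associator, h.associator_mul', h.associator_mul,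
      h.associator_associator, h.associator_associator, mul_zero, mul_zero, zero_add,
      zero_add] at this
    exact eq_neg_of_add_eq_zero_left this
  refine self_eq_neg.1 (?_ : g a b c d e f = -g a b c d e f)
  conv_lhs => rw [hs, hn, hs, hn, hs, hn, neg_neg]

theorem isCentralizing_associator [IsAddTorsionFree A] (h : IsAssosymmetric A) (a b c : A) :
    IsCentralizing (associator a b c) where
  associator_eq_zero := h.associator_associator a b c
  commutator_mul d e := by rw [h.commutator_mul_comm, h.associator_mul_commutator]
  mul_commutator d e := h.associator_mul_commutator _ _ _ _ _
  associator_mul _ _ _ := h.associator_mul_associator _ _ _ _ _ _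
  mul_associator _ _ _ := h.associator_mul_associator _ _ _ _ _ _

end IsAssosymmetric

/-! ### Closure properties of centralizing elements. -/

namespace IsCentralizing

variable {A : Type*} [NonUnitalNonAssocRing A] {u : A}

theorem associator_right (h : IsAssosymmetric A) (hu : IsCentralizing u) (a b : A) :
    associator a b u = 0 := by
  rw [← h.rotate, hu.associator_eq_zero]

theorem associator_mid (h : IsAssosymmetric A) (hu : IsCentralizing u) (a b : A) :
    associator a u b = 0 := by
  rw [h.left, hu.associator_eq_zero]

/-- `a (b u) = (a b) u`. -/
theorem mul_mul_left (h : IsAssosymmetric A) (hu : IsCentralizing u) (a b : A) :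
    a * b * u = a * (b * u) :=
  sub_eq_zero.1 (hu.associator_right h a b)

theorem mul_mul_mid (h : IsAssosymmetric A) (hu : IsCentralizing u) (a b : A) :
    a * u * b = a * (u * b) :=
  sub_eq_zero.1 (hu.associator_mid h a b)

theorem mul_mul_right (hu : IsCentralizing u) (a b : A) : u * a * b = u * (a * b) :=
  sub_eq_zero.1 (hu.associator_eq_zero a b)

theorem mul_left_comm (h : IsAssosymmetric A) (hu : IsCentralizing u) (a b : A) :
    a * (b * u) = b * (a * u) := by
  rw [← hu.mul_mul_left h, ← hu.mul_mul_left h, ← sub_eq_zero, ← sub_mul, hu.commutator_mul]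

theorem mul_right_comm (hu : IsCentralizing u) (a b : A) : u * a * b = u * b * a := by
  rw [hu.mul_mul_right, hu.mul_mul_right, ← sub_eq_zero, ← mul_sub, hu.mul_commutator]

theorem zero : IsCentralizing (0 : A) := by
  constructor <;> simp [associator_apply]

theorem sub {v : A} (hu : IsCentralizing u) (hv : IsCentralizing v) : IsCentralizing (u - v) where
  associator_eq_zero a b := by
    rw [IsAssosymmetric.sub_associator, hu.associator_eq_zero, hv.associator_eq_zero, sub_zero]
  commutator_mul a b := by rw [mul_sub, hu.commutator_mul, hv.commutator_mul, sub_zero]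
  mul_commutator a b := by rw [sub_mul, hu.mul_commutator, hv.mul_commutator, sub_zero]
  associator_mul a b c := by rw [mul_sub, hu.associator_mul, hv.associator_mul, sub_zero]
  mul_associator a b c := by rw [sub_mul, hu.mul_associator, hv.mul_associator, sub_zero]

theorem mul_left [IsAddTorsionFree A] (h : IsAssosymmetric A) (hu : IsCentralizing u) (x : A) :
    IsCentralizing (x * u) where
  associator_eq_zero a b := by
    rw [h.associator_mul, hu.mul_associator, hu.associator_eq_zero, zero_mul, add_zero]
  commutator_mul a b := by
    -- Rewrites `[a,b]x` through commutators and an associator, each of which annihilates `u` from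
    -- the left.
    have e : (a * b - b * a) * x = (a * x) * b - b * (a * x) - a * (x * b - b * x) -
        associator a x b := by
      rw [h.commutator_mul_eq a x b]
      abel
    rw [← hu.mul_mul_left h, e, sub_mul, sub_mul, hu.commutator_mul, hu.mul_mul_left h,
      hu.commutator_mul, hu.associator_mul, mul_zero, sub_zero, sub_zero]
  mul_commutator a b := by rw [hu.mul_mul_mid h, hu.mul_commutator, mul_zero]
  associator_mul a b c := by
    have e : associator a b c * x = associator (x * a) b c - a * associator x b c := by
      rw [h.associator_mul' x, ← h.associator_mul', h.associator_mul]
      abel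
    rw [← hu.mul_mul_left h, e, sub_mul, hu.mul_mul_left h, hu.associator_mul, hu.associator_mul,
      mul_zero, sub_zero]
  mul_associator a b c := by rw [hu.mul_mul_mid h, hu.mul_associator, mul_zero]

theorem mul_right [IsAddTorsionFree A] (h : IsAssosymmetric A) (hu : IsCentralizing u) (x : A) :
    IsCentralizing (u * x) where
  associator_eq_zero a b := by
    rw [h.associator_mul, hu.associator_mul, hu.associator_eq_zero, mul_zero, add_zero]
  commutator_mul a b := by rw [← hu.mul_mul_mid h, hu.commutator_mul, zero_mul]
  mul_commutator a b := by
    have e : x * (a * b - b * a) = (x * a) * b - b * (x * a) - (x * b - b * x) * a -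
        associator x a b := by
      rw [h.commutator_mul_eq x a b]
      abel
    rw [hu.mul_mul_right, e, mul_sub, mul_sub, hu.mul_commutator, ← hu.mul_mul_right,
      hu.mul_commutator, hu.mul_associator, zero_mul, sub_zero, sub_zero]
  associator_mul a b c := by rw [← hu.mul_mul_mid h, hu.associator_mul, zero_mul]
  mul_associator a b c := by
    have e : x * associator a b c = associator (a * x) b c - associator x b c * a := by
      rw [h.associator_mul a]
      abel
    rw [hu.mul_mul_right, e, mul_sub, ← hu.mul_mul_right, hu.mul_associator, hu.mul_associator,
      zero_mul, sub_zero]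

end IsCentralizing

/-! ### Symmetry of nested products in their letters. -/

/-- A function of lists that is invariant under swaps of neighbours is invariant under
permutations. -/
theorem eq_of_perm {α β : Type*} {f : List α → β}
    (hf : ∀ p a b r, f (p ++ a :: b :: r) = f (p ++ b :: a :: r)) {l l' : List α}
    (hl : l.Perm l') : f l = f l' := by
  -- The prefix `p` absorbs the heads met in the `cons` case of the induction.
  suffices ∀ p, f (p ++ l) = f (p ++ l') from this []
  induction hl with
  | nil => exact fun _ => rfl
  | cons a _ ih => exact fun p => by simpa using ih (p ++ [a])
  | swap a b r => exact fun p => hf p b a r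
  | trans _ _ ih1 ih2 => exact fun p => (ih1 p).trans (ih2 p)

/-- The product `a₁ (a₂ (... (a_k c) ...))`, where `c` is the iterated commutator of the
associator of `m`. -/
def nestedProduct {A : Type*} [NonUnitalNonAssocRing A] (l m : List A) : A :=
  l.foldr (fun a v => a * v) (commutatorOfAssociator m)

section

variable {A : Type*} [NonUnitalNonAssocRing A]

theorem nestedProduct_nil (m : List A) : nestedProduct [] m = commutatorOfAssociator m := rfl

theorem nestedProduct_cons (a : A) (l m : List A) :
    nestedProduct (a :: l) m = a * nestedProduct l m := rfl

theorem commutatorOfAssociator_of_length_lt {m : List A} (hm : m.length < 3) :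
    commutatorOfAssociator m = 0 := by
  match m, hm with
  | [], _ | [_], _ | [_, _], _ => rfl

theorem commutatorOfAssociator_append {m : List A} (hm : 3 ≤ m.length) (a : A) :
    commutatorOfAssociator (m ++ [a]) =
      commutatorOfAssociator m * a - a * commutatorOfAssociator m := by
  match m, hm with
  | x :: y :: z :: l, _ => simp [commutatorOfAssociator]

theorem leftNormed_append {l : List A} (hl : l ≠ []) (a : A) :
    leftNormed (l ++ [a]) = leftNormed l * a := by
  match l, hl with
  | x :: l, _ => simp [leftNormed]

theorem IsCentralizing.smul {K : Type*} [Field K] [Module K A] [IsScalarTower K A A]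
    [SMulCommClass K A A] {u : A} (hu : IsCentralizing u) (c : K) : IsCentralizing (c • u) where
  associator_eq_zero a b := by
    have := congrArg (c • ·) (hu.associator_eq_zero a b)
    simpa only [associator_apply, smul_sub, smul_mul_assoc, smul_zero] using this
  commutator_mul a b := by rw [mul_smul_comm, hu.commutator_mul, smul_zero]
  mul_commutator a b := by rw [smul_mul_assoc, hu.mul_commutator, smul_zero]
  associator_mul a b d := by rw [mul_smul_comm, hu.associator_mul, smul_zero]
  mul_associator a b d := by rw [smul_mul_assoc, hu.mul_associator, smul_zero]

variable [IsAddTorsionFree A] (h : IsAssosymmetric A)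
include h

theorem IsCentralizing.foldl {u : A} (hu : IsCentralizing u) (l : List A) :
    IsCentralizing (l.foldl (fun u v => u * v - v * u) u) := by
  induction l generalizing u with
  | nil => exact hu
  | cons a l ih => exact ih ((hu.mul_right h a).sub (hu.mul_left h a))

theorem isCentralizing_commutatorOfAssociator (m : List A) :
    IsCentralizing (commutatorOfAssociator m) := by
  match m with
  | [] | [_] | [_, _] => exact .zero
  | a :: b :: c :: l => exact (h.isCentralizing_associator a b c).foldl h l

theorem isCentralizing_nestedProduct (l m : List A) : IsCentralizing (nestedProduct l m) := by
  induction l with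
  | nil => exact isCentralizing_commutatorOfAssociator h m
  | cons a l ih => exact ih.mul_left h a

/-- Neighbour swaps suffice. Inside the associator they are assosymmetry, across its border they are
`commutator_associator_swap`, and further out the operators `u ↦ ua - au` commute because `u` is
centralizing. -/
theorem commutatorOfAssociator_perm {m m' : List A} (hm : m.Perm m') :
    commutatorOfAssociator m = commutatorOfAssociator m' := by
  refine eq_of_perm (fun p a b r => ?_) hm
  match p, r with
  | [], [] => rfl
  | [], c :: r => simp only [List.nil_append, commutatorOfAssociator, h.left a b c]
  | [x], r => simp only [List.cons_append, List.nil_append, commutatorOfAssociator, h.right x a b]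
  | [x, y], r =>
    simp only [List.cons_append, List.nil_append, commutatorOfAssociator, List.foldl_cons]
    congr 1
    rw [← h.rotate b x y, ← h.rotate a x y, h.commutator_associator_swap]
  | x :: y :: z :: p, r =>
    simp only [List.cons_append, commutatorOfAssociator, List.foldl_append, List.foldl_cons]
    congr 1
    have hu := (h.isCentralizing_associator x y z).foldl h p
    generalize p.foldl (fun u v => u * v - v * u) (associator x y z) = u at hu
    have e1 := hu.mul_right_comm a b
    have e2 := hu.mul_left_comm h a b
    have e3 := hu.mul_mul_mid h a b
    have e4 := hu.mul_mul_mid h b a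
    simp only [mul_sub, sub_mul]
    rw [e1, e2, e3, e4]
    abel

theorem nestedProduct_perm {l l' m m' : List A} (hl : l.Perm l') (hm : m.Perm m') :
    nestedProduct l m = nestedProduct l' m' := by
  have e : nestedProduct l m = nestedProduct l m' := by
    rw [nestedProduct, commutatorOfAssociator_perm h hm, nestedProduct]
  rw [e]
  refine eq_of_perm (f := fun l => nestedProduct l m') (fun p a b r => ?_) hl
  induction p with
  | nil => exact (isCentralizing_nestedProduct h r m').mul_left_comm h a b
  | cons c p ih => exact congrArg (c * ·) ih

/-- At the core `u`, `ua = au + [u,a]`; the letter `a` then commutes past the outer factors. This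
closes the span of the second type under right multiplication by letters. -/
theorem nestedProduct_mul (l : List A) {m : List A} (hm : 3 ≤ m.length) (a : A) :
    nestedProduct l m * a = nestedProduct (a :: l) m + nestedProduct l (m ++ [a]) := by
  induction l with
  | nil =>
    rw [nestedProduct_cons, nestedProduct_nil, nestedProduct_nil, commutatorOfAssociator_append hm]
    abel
  | cons b l ih =>
    have hu := isCentralizing_nestedProduct h l m
    rw [nestedProduct_cons, hu.mul_mul_mid h, ih, mul_add, nestedProduct_cons, nestedProduct_cons,
      nestedProduct_cons, nestedProduct_cons, hu.mul_left_comm h]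

end

/-! ### Words in the free algebra reduce to the two types. -/

section

variable {K X Y : Type*} [Field K]

theorem isAssosymmetric (K X : Type*) [Field K] : IsAssosymmetric (FreeAssosymmetric K X) where
  right a b c := by
    obtain ⟨a, rfl⟩ := proj_surjective a
    obtain ⟨b, rfl⟩ := proj_surjective b
    obtain ⟨c, rfl⟩ := proj_surjective c
    simp only [associator_apply, ← proj_mul, ← map_sub]
    exact proj_eq_iff.2 (verbalIdeal_right a b c)
  left a b c := by
    obtain ⟨a, rfl⟩ := proj_surjective a
    obtain ⟨b, rfl⟩ := proj_surjective b
    obtain ⟨c, rfl⟩ := proj_surjective c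
    simp only [associator_apply, ← proj_mul, ← map_sub]
    exact proj_eq_iff.2 (verbalIdeal_left a b c)

instance [CharZero K] : IsAddTorsionFree (FreeAssosymmetric K X) :=
  .of_isTorsionFree K _

theorem monomial_mul (v w : FreeMagma X) : monomial K (v * w) = monomial K v * monomial K w := by
  rw [monomial, map_mul, proj_mul]
  rfl

theorem multidegree_mul (v w : FreeMagma X) :
    multidegree (v * w) = multidegree v + multidegree w := rfl

/-- The span of the elements of the second type whose multiset of letters is `μ`. -/
def secondSpan (K : Type*) {X : Type*} [Field K] (μ : Multiset X) :
    Submodule K (FreeAssosymmetric K X) :=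
  Submodule.span K {u | ∃ l m : List X, 3 ≤ m.length ∧ ((l ++ m : List X) : Multiset X) = μ ∧
    u = nestedProduct (l.map (gen K)) (m.map (gen K))}

/-- The span of the elements of the first type whose multiset of letters is `μ`. -/
def firstSpan (K : Type*) {X : Type*} [Field K] (μ : Multiset X) :
    Submodule K (FreeAssosymmetric K X) :=
  Submodule.span K {u | ∃ l : List X, (l : Multiset X) = μ ∧ u = leftNormed (l.map (gen K))}

variable [CharZero K]

theorem isCentralizing_of_mem_secondSpan {μ : Multiset X} {u : FreeAssosymmetric K X}
    (hu : u ∈ secondSpan K μ) : IsCentralizing u := by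
  induction hu using Submodule.span_induction with
  | mem x hx =>
    obtain ⟨l, m, -, -, rfl⟩ := hx
    exact isCentralizing_nestedProduct (isAssosymmetric K X) _ _
  | zero => exact .zero
  -- Uses `x + y = x - (0 - y)`, as closure is available for differences.
  | add x y _ _ hx hy => simpa using hx.sub (IsCentralizing.zero.sub hy)
  | smul c x _ hx => exact hx.smul c

theorem monomial_mul_mem_secondSpan (w : FreeMagma X) {μ : Multiset X}
    {u : FreeAssosymmetric K X} (hu : u ∈ secondSpan K μ) :
    monomial K w * u ∈ secondSpan K (multidegree w + μ) := by
  induction w using FreeMagma.recOnMul generalizing μ u with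
  | ih1 x =>
    induction hu using Submodule.span_induction with
    | mem u hu =>
      obtain ⟨l, m, hm, rfl, rfl⟩ := hu
      exact Submodule.subset_span ⟨x :: l, m, hm, rfl, rfl⟩
    | zero => rw [mul_zero]; exact zero_mem _
    | add u v _ _ hu hv => rw [mul_add]; exact add_mem hu hv
    | smul c u _ hu => rw [mul_smul_comm]; exact Submodule.smul_mem _ c hu
  | ih2 a b ha hb =>
    rw [monomial_mul, (isCentralizing_of_mem_secondSpan hu).mul_mul_left (isAssosymmetric K X),
      multidegree_mul, add_assoc]
    exact ha (hb hu)

theorem mul_monomial_mem_secondSpan (w : FreeMagma X) {μ : Multiset X}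
    {u : FreeAssosymmetric K X} (hu : u ∈ secondSpan K μ) :
    u * monomial K w ∈ secondSpan K (multidegree w + μ) := by
  induction w using FreeMagma.recOnMul generalizing μ u with
  | ih1 x =>
    induction hu using Submodule.span_induction with
    | mem u hu =>
      obtain ⟨l, m, hm, rfl, rfl⟩ := hu
      have e := nestedProduct_mul (isAssosymmetric K X) (l.map (gen K)) (m := m.map (gen K))
        (by simpa using hm) (gen K x)
      refine (congrArg (· ∈ secondSpan K _) e).mpr (add_mem ?_ ?_)
      · exact Submodule.subset_span ⟨x :: l, m, hm, rfl, rfl⟩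
      · refine Submodule.subset_span ⟨l, m ++ [x], by simp; omega, ?_, by simp⟩
        change _ = ((x :: (l ++ m) : List X) : Multiset X)
        exact Multiset.coe_eq_coe.2 (List.append_assoc l m [x] ▸ List.perm_append_singleton x (l ++
          m))
    | zero => rw [zero_mul]; exact zero_mem _
    | add u v _ _ hu hv => rw [add_mul]; exact add_mem hu hv
    | smul c u _ hu => rw [smul_mul_assoc]; exact Submodule.smul_mem _ c hu
  | ih2 a b ha hb =>
    rw [monomial_mul, ← (isCentralizing_of_mem_secondSpan hu).mul_mul_right,
      multidegree_mul, add_comm (multidegree a), add_assoc]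
    exact hb (ha hu)

/-- A composite argument is rotated into the first slot and split by the product rule, until all
three arguments are letters. -/
theorem associator_monomial_mem (a b c : FreeMagma X) :
    associator (monomial K a) (monomial K b) (monomial K c) ∈
      secondSpan K (multidegree a + multidegree b + multidegree c) := by
  have h := isAssosymmetric K X
  induction a using FreeMagma.recOnMul generalizing b c with
  | ih1 x =>
    induction b using FreeMagma.recOnMul generalizing c with
    | ih1 y =>
      induction c using FreeMagma.recOnMul with
      | ih1 z => exact Submodule.subset_span ⟨[], [x, y, z], le_rfl, rfl, rfl⟩
      | ih2 c d hc hd =>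
        rw [h.rotate, h.rotate, monomial_mul, h.associator_mul, multidegree_mul]
        refine add_mem ?_ ?_
        · rw [h.rotate]
          convert monomial_mul_mem_secondSpan d hc using 2
          ac_rfl
        · rw [h.rotate]
          convert mul_monomial_mem_secondSpan c hd using 2
          ac_rfl
    | ih2 b d hb hd =>
      rw [h.left, monomial_mul, h.associator_mul, multidegree_mul]
      refine add_mem ?_ ?_
      · rw [h.left]
        convert monomial_mul_mem_secondSpan d (hb c) using 2
        ac_rfl
      · rw [h.left]
        convert mul_monomial_mem_secondSpan b (hd c) using 2
        ac_rfl
  | ih2 a d ha hd =>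
    rw [monomial_mul, h.associator_mul, multidegree_mul]
    refine add_mem ?_ ?_
    · convert monomial_mul_mem_secondSpan d (ha b c) using 2
      ac_rfl
    · convert mul_monomial_mem_secondSpan a (hd b c) using 2
      ac_rfl

/-- In `key` the induction is on the right factor, for all left factors at once: `a(bc)` becomes
`(ab)c` up to an associator, and multiplying by a letter on the right keeps left-normed products
left-normed. -/
theorem monomial_mem (w : FreeMagma X) :
    monomial K w ∈ firstSpan K (multidegree w) ⊔ secondSpan K (multidegree w) := by
  have key (a b : FreeMagma X)
      (ha : monomial K a ∈ firstSpan K (multidegree a) ⊔ secondSpan K (multidegree a)) :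
      monomial K (a * b) ∈
        firstSpan K (multidegree (a * b)) ⊔ secondSpan K (multidegree (a * b)) := by
    induction b using FreeMagma.recOnMul generalizing a with
    | ih1 x =>
      obtain ⟨u, hu, v, hv, e⟩ := Submodule.mem_sup.1 ha
      rw [monomial_mul, ← e, add_mul]
      refine add_mem (Submodule.mem_sup_left ?_) (Submodule.mem_sup_right ?_)
      · clear e
        induction hu using Submodule.span_induction with
        | mem u hu =>
          obtain ⟨l, hl, rfl⟩ := hu
          -- The empty list is harmless since `leftNormed [] = 0`.
          rcases eq_or_ne l [] with rfl | hne
          · rw [List.map_nil, leftNormed, zero_mul]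
            · exact zero_mem _
            · simp
          · refine Submodule.subset_span ⟨l ++ [x], ?_, ?_⟩
            · rw [multidegree_mul, ← hl]
              rfl
            · rw [List.map_append, List.map_singleton, leftNormed_append (by simpa using hne)]
              rfl
        | zero => rw [zero_mul]; exact zero_mem _
        | add u v _ _ hu hv => rw [add_mul]; exact add_mem hu hv
        | smul c u _ hu => rw [smul_mul_assoc]; exact Submodule.smul_mem _ c hu
      · rw [multidegree_mul, add_comm]
        exact mul_monomial_mem_secondSpan _ hv
    | ih2 b c hb hc =>
      have e : monomial K (a * (b * c)) = monomial K (a * b * c) -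
          associator (monomial K a) (monomial K b) (monomial K c) := by
        simp only [monomial_mul, associator_apply]
        abel
      have e' : multidegree (a * (b * c)) = multidegree (a * b * c) :=
        (add_assoc _ _ _).symm
      rw [e, e']
      exact sub_mem (hc _ (hb a ha)) (Submodule.mem_sup_right (associator_monomial_mem a b c))
  induction w using FreeMagma.recOnMul with
  | ih1 x => exact Submodule.mem_sup_left (Submodule.subset_span ⟨[x], rfl, rfl⟩)
  | ih2 a b ha _ => exact key a b ha

end

/-! ### Homomorphisms, lifts and renamings. -/

section Hom

variable {A B : Type*} [NonUnitalNonAssocRing A] [NonUnitalNonAssocRing B]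

theorem map_leftNormed (φ : A →ₙ+* B) (l : List A) : φ (leftNormed l) = leftNormed (l.map φ) := by
  induction l using List.reverseRecOn with
  | nil => exact map_zero φ
  | append_singleton l a ih =>
    rcases eq_or_ne l [] with rfl | hl
    · rfl
    · rw [leftNormed_append hl, map_mul, ih, List.map_append, List.map_singleton,
        leftNormed_append (by simpa using hl)]

theorem map_commutatorOfAssociator (φ : A →ₙ+* B) (m : List A) :
    φ (commutatorOfAssociator m) = commutatorOfAssociator (m.map φ) := by
  match m with
  | [] | [_] | [_, _] => exact map_zero φ
  | a :: b :: c :: l =>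
    induction l using List.reverseRecOn with
    | nil => simp [commutatorOfAssociator, associator_apply]
    | append_singleton l d ih =>
      have e := commutatorOfAssociator_append (m := a :: b :: c :: l) (by simp) d
      have e' := commutatorOfAssociator_append (m := (a :: b :: c :: l).map φ) (by simp) (φ d)
      simp only [List.cons_append] at e
      rw [e, map_sub, map_mul, map_mul, ih, ← e']
      simp

theorem map_nestedProduct (φ : A →ₙ+* B) (l m : List A) :
    φ (nestedProduct l m) = nestedProduct (l.map φ) (m.map φ) := by
  induction l with
  | nil => exact map_commutatorOfAssociator φ m
  | cons a l ih => rw [nestedProduct_cons, map_mul, ih, List.map_cons, nestedProduct_cons]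

end Hom

section Lift

variable {K X Y B : Type*} [Field K] [NonUnitalNonAssocRing B] [Module K B]
  [IsScalarTower K B B] [SMulCommClass K B B]

/-- The homomorphism from the free assosymmetric algebra to an assosymmetric algebra with
prescribed values on the generators, as a linear map. -/
def lift (hB : IsAssosymmetric B) (f : X → B) : FreeAssosymmetric K X →ₗ[K] B :=
  (verbalIdeal K X).liftQ
    (FreeNonUnitalNonAssocAlgebra.lift K f : FreeNonUnitalNonAssocAlgebra K X →ₗ[K] B) (by
      refine sInf_le ⟨fun a b c => ?_, fun a b c => ?_, fun a x hx => ⟨?_, ?_⟩⟩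
      · have := hB.right (FreeNonUnitalNonAssocAlgebra.lift K f a)
          (FreeNonUnitalNonAssocAlgebra.lift K f b) (FreeNonUnitalNonAssocAlgebra.lift K f c)
        simpa [associator_apply, sub_eq_zero] using! this
      · have := hB.left (FreeNonUnitalNonAssocAlgebra.lift K f a)
          (FreeNonUnitalNonAssocAlgebra.lift K f b) (FreeNonUnitalNonAssocAlgebra.lift K f c)
        simpa [associator_apply, sub_eq_zero] using! this
      · have hx : FreeNonUnitalNonAssocAlgebra.lift K f x = 0 := hx
        change FreeNonUnitalNonAssocAlgebra.lift K f (a * x) = 0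
        rw [map_mul, hx, mul_zero]
      · have hx : FreeNonUnitalNonAssocAlgebra.lift K f x = 0 := hx
        change FreeNonUnitalNonAssocAlgebra.lift K f (x * a) = 0
        rw [map_mul, hx, zero_mul])

theorem lift_proj (hB : IsAssosymmetric B) (f : X → B) (a : FreeNonUnitalNonAssocAlgebra K X) :
    lift hB f (proj K X a) = FreeNonUnitalNonAssocAlgebra.lift K f a := rfl

theorem lift_mul (hB : IsAssosymmetric B) (f : X → B) (a b : FreeAssosymmetric K X) :
    lift hB f (a * b) = lift hB f a * lift hB f b := by
  obtain ⟨a, rfl⟩ := proj_surjective a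
  obtain ⟨b, rfl⟩ := proj_surjective b
  rw [← proj_mul, lift_proj, lift_proj, lift_proj, map_mul]

theorem lift_gen (hB : IsAssosymmetric B) (f : X → B) (x : X) :
    lift (K := K) hB f (gen K x) = f x :=
  FreeNonUnitalNonAssocAlgebra.lift_of_apply K f x

/-- The ring homomorphism underlying `lift`. -/
def liftHom (hB : IsAssosymmetric B) (f : X → B) : FreeAssosymmetric K X →ₙ+* B where
  toFun := lift (K := K) hB f
  map_mul' := lift_mul hB f
  map_zero' := map_zero _
  map_add' := map_add _

theorem lift_leftNormed (hB : IsAssosymmetric B) (f : X → B) (l : List X) :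
    lift (K := K) hB f (leftNormed (l.map (gen K))) = leftNormed (l.map f) := by
  refine (map_leftNormed (liftHom (K := K) hB f) _).trans ?_
  rw [List.map_map]
  exact congrArg leftNormed (List.map_congr_left fun x _ => lift_gen hB f x)

theorem lift_nestedProduct (hB : IsAssosymmetric B) (f : X → B) (l m : List X) :
    lift (K := K) hB f (nestedProduct (l.map (gen K)) (m.map (gen K))) =
      nestedProduct (l.map f) (m.map f) := by
  refine (map_nestedProduct (liftHom (K := K) hB f) _ _).trans ?_
  rw [List.map_map, List.map_map]
  exact congrArg₂ nestedProduct (List.map_congr_left fun x _ => lift_gen hB f x)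
    (List.map_congr_left fun x _ => lift_gen hB f x)

theorem rename_mul (f : X → Y) (a b : FreeAssosymmetric K X) :
    rename K f (a * b) = rename K f a * rename K f b := by
  obtain ⟨a, rfl⟩ := proj_surjective a
  obtain ⟨b, rfl⟩ := proj_surjective b
  rw [← proj_mul, rename_proj, rename_proj, rename_proj, map_mul, proj_mul]

/-- The ring homomorphism underlying `rename`. -/
def renameHom (K : Type*) {X Y : Type*} [Field K] (f : X → Y) :
    FreeAssosymmetric K X →ₙ+* FreeAssosymmetric K Y where
  toFun := rename K f
  map_mul' := rename_mul f
  map_zero' := map_zero _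
  map_add' := map_add _

theorem rename_leftNormed (f : X → Y) (l : List X) :
    rename K f (leftNormed (l.map (gen K))) = leftNormed ((l.map f).map (gen K)) := by
  refine (map_leftNormed (renameHom K f) _).trans ?_
  rw [List.map_map, List.map_map]
  exact congrArg leftNormed (List.map_congr_left fun x _ => rename_monomial f _)

theorem rename_nestedProduct (f : X → Y) (l m : List X) :
    rename K f (nestedProduct (l.map (gen K)) (m.map (gen K))) =
      nestedProduct ((l.map f).map (gen K)) ((m.map f).map (gen K)) := by
  refine (map_nestedProduct (renameHom K f) _ _).trans ?_
  rw [List.map_map, List.map_map, List.map_map, List.map_map]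
  exact congrArg₂ nestedProduct (List.map_congr_left fun x _ => rename_monomial f _)
    (List.map_congr_left fun x _ => rename_monomial f _)

end Lift

/-! ### Associative rings as a model that kills the second type. -/

section Associative

variable {B : Type*} [Ring B]

theorem isAssosymmetric_of_ring (B : Type*) [Ring B] : IsAssosymmetric B where
  right a b c := by simp [associator_apply, mul_assoc]
  left a b c := by simp [associator_apply, mul_assoc]

theorem leftNormed_eq_prod {l : List B} (hl : l ≠ []) : leftNormed l = l.prod := by
  match l, hl with
  | a :: l, _ => simp [leftNormed, List.prod_eq_foldl]

theorem commutatorOfAssociator_eq_zero (m : List B) : commutatorOfAssociator m = 0 := by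
  match m with
  | [] | [_] | [_, _] => rfl
  | a :: b :: c :: l =>
    have e : associator a b c = 0 := by simp [associator_apply, mul_assoc]
    rw [commutatorOfAssociator, e]
    induction l with
    | nil => rfl
    | cons d l ih => simpa using ih

theorem nestedProduct_eq_zero (l m : List B) : nestedProduct l m = 0 := by
  induction l with
  | nil => exact commutatorOfAssociator_eq_zero m
  | cons a l ih => rw [nestedProduct_cons, ih, mul_zero]

end Associative

/-! ### A non-associative model that detects the second type. -/

/-- The triples over a commutative ring with the product
`(p, q, u) (p', q', u') = (p p', q q', p u' + u q' + (q - p) (q' - p'))`. -/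
def TripleAlgebra (R : Type*) : Type _ := R × R × R

namespace TripleAlgebra

section Components

variable {R : Type*}

/-- The triple with the given components. -/
def mk (p q u : R) : TripleAlgebra R := (p, q, u)

/-- The first component. -/
def left (a : TripleAlgebra R) : R := Prod.fst a

/-- The second component. -/
def right (a : TripleAlgebra R) : R := Prod.fst (Prod.snd a)

/-- The third component. -/
def extra (a : TripleAlgebra R) : R := Prod.snd (Prod.snd a)

theorem ext {a b : TripleAlgebra R} (h1 : a.left = b.left) (h2 : a.right = b.right)
    (h3 : a.extra = b.extra) : a = b :=
  Prod.ext h1 (Prod.ext h2 h3)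

theorem mk_left (p q u : R) : (mk p q u).left = p := rfl

theorem mk_right (p q u : R) : (mk p q u).right = q := rfl

theorem mk_extra (p q u : R) : (mk p q u).extra = u := rfl

end Components

variable {R : Type*} [CommRing R]

instance : AddCommGroup (TripleAlgebra R) := inferInstanceAs (AddCommGroup (R × R × R))

instance {K : Type*} [Field K] [Algebra K R] : Module K (TripleAlgebra R) :=
  inferInstanceAs (Module K (R × R × R))

instance : Mul (TripleAlgebra R) where
  mul a b := mk (a.left * b.left) (a.right * b.right)
    (a.left * b.extra + a.extra * b.right + (a.right - a.left) * (b.right - b.left))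

theorem mul_left (a b : TripleAlgebra R) : (a * b).left = a.left * b.left := rfl

theorem mul_right (a b : TripleAlgebra R) : (a * b).right = a.right * b.right := rfl

theorem mul_extra (a b : TripleAlgebra R) :
    (a * b).extra = a.left * b.extra + a.extra * b.right + (a.right - a.left) * (b.right - b.left)
      := rfl

theorem zero_left : (0 : TripleAlgebra R).left = 0 := rfl

theorem zero_right : (0 : TripleAlgebra R).right = 0 := rfl

theorem zero_extra : (0 : TripleAlgebra R).extra = 0 := rfl

theorem add_left (a b : TripleAlgebra R) : (a + b).left = a.left + b.left := rfl

theorem add_right (a b : TripleAlgebra R) : (a + b).right = a.right + b.right := rfl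

theorem add_extra (a b : TripleAlgebra R) : (a + b).extra = a.extra + b.extra := rfl

theorem sub_left (a b : TripleAlgebra R) : (a - b).left = a.left - b.left := rfl

theorem sub_right (a b : TripleAlgebra R) : (a - b).right = a.right - b.right := rfl

theorem sub_extra (a b : TripleAlgebra R) : (a - b).extra = a.extra - b.extra := rfl

instance : NonUnitalNonAssocRing (TripleAlgebra R) where
  left_distrib a b c := by
    apply ext <;> simp only [mul_left, mul_right, mul_extra, add_left, add_right, add_extra] <;>
      ring
  right_distrib a b c := by
    apply ext <;> simp only [mul_left, mul_right, mul_extra, add_left, add_right, add_extra] <;>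
      ring
  zero_mul a := by
    apply ext <;> simp only [mul_left, mul_right, mul_extra, zero_left, zero_right, zero_extra] <;>
      ring
  mul_zero a := by
    apply ext <;> simp only [mul_left, mul_right, mul_extra, zero_left, zero_right, zero_extra] <;>
      ring

section Module

variable {K : Type*} [Field K] [Algebra K R]

theorem smul_left (c : K) (a : TripleAlgebra R) : (c • a).left = c • a.left := rfl

theorem smul_right (c : K) (a : TripleAlgebra R) : (c • a).right = c • a.right := rfl

theorem smul_extra (c : K) (a : TripleAlgebra R) : (c • a).extra = c • a.extra := rfl

instance : IsScalarTower K (TripleAlgebra R) (TripleAlgebra R) where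
  smul_assoc c a b := by
    apply ext <;> simp only [smul_eq_mul, mul_left, mul_right, mul_extra, smul_left, smul_right,
      smul_extra,
      Algebra.smul_def] <;> ring

instance : SMulCommClass K (TripleAlgebra R) (TripleAlgebra R) where
  smul_comm c a b := by
    apply ext <;> simp only [smul_eq_mul, mul_left, mul_right, mul_extra, smul_left, smul_right,
      smul_extra,
      Algebra.smul_def] <;> ring

/-- The projection to the third component. -/
def extraLinear (K R : Type*) [Field K] [CommRing R] [Algebra K R] : TripleAlgebra R →ₗ[K] R :=
  LinearMap.snd K R R ∘ₗ LinearMap.snd K R (R × R)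

theorem extraLinear_mk (p q u : R) : extraLinear K R (mk p q u) = u := rfl

end Module

/-- With `δ = right - left`, the term `δ(a)δ(b)` in the product is a 2-cochain whose coboundary is,
up to sign, the visibly symmetric `δ(a)δ(b)δ(c)`; the rest of the product is associative. -/
theorem associator_eq (a b c : TripleAlgebra R) :
    associator a b c = mk 0 0 ((a.right - a.left) * (b.right - b.left) * (c.right - c.left)) := by
  apply ext <;>
    simp only [associator_apply, mk_left, mk_right, mk_extra, mul_left, mul_right, mul_extra,
      sub_left, sub_right, sub_extra] <;> ring

theorem isAssosymmetric (R : Type*) [CommRing R] : IsAssosymmetric (TripleAlgebra R) where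
  right a b c := by rw [associator_eq, associator_eq, mul_right_comm]
  left a b c := by
    rw [associator_eq, associator_eq, mul_comm (a.right - a.left)]

/-- On a triple `(0, 0, u)`, right multiplication by `d` scales `u` by `d.right` and left
multiplication by `d.left`, so each commutator contributes a factor `d.right - d.left`. -/
theorem commutatorOfAssociator_eq {m : List (TripleAlgebra R)} (hm : 3 ≤ m.length) :
    commutatorOfAssociator m =
      mk 0 0 ((m.map fun a => a.right - a.left).prod) := by
  match m, hm with
  | a :: b :: c :: l, _ =>
    induction l using List.reverseRecOn with
    | nil =>
      refine (associator_eq a b c).trans ?_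
      simp only [List.map_cons, List.map_nil, List.prod_cons, List.prod_nil, mul_one, mul_assoc]
    | append_singleton l d ih =>
      have e := commutatorOfAssociator_append (m := a :: b :: c :: l) (by simp) d
      simp only [List.cons_append] at e
      rw [e, ih (by simp)]
      apply ext <;> simp only [mk_left, mk_right, mk_extra, mul_left, mul_right, mul_extra,
        sub_left, sub_right, sub_extra,
        List.map_cons, List.map_append, List.prod_append, List.prod_cons, List.map_nil,
        List.prod_nil] <;> ring

theorem nestedProduct_eq (l : List (TripleAlgebra R)) {m : List (TripleAlgebra R)}
    (hm : 3 ≤ m.length) :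
    nestedProduct l m = mk 0 0 ((l.map fun a => a.left).prod *
      (m.map fun a => a.right - a.left).prod) := by
  induction l with
  | nil =>
    rw [List.map_nil, List.prod_nil, one_mul]
    exact commutatorOfAssociator_eq hm
  | cons a l ih =>
    rw [nestedProduct_cons, ih]
    apply ext <;> simp only [mk_left, mk_right, mk_extra, mul_left, mul_right, mul_extra,
      List.map_cons, List.prod_cons] <;> ring

end TripleAlgebra

/-! ### Linear independence of both types. -/

/-- `x_{s(1)} (... (x_{s(k)} [...[(x_{t(1)}, x_{t(2)}, x_{t(3)}), x_{t(4)}], ..., x_{t(m)}])...)`,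
where `s(1), ..., s(k)` are the elements of `s` and `t(1), ..., t(m)` those of its complement. -/
def subsetElement (K : Type*) {X : Type*} [Field K] [Fintype X] [DecidableEq X] (s : Finset X) :
    FreeAssosymmetric K X :=
  nestedProduct (s.toList.map (gen K)) (sᶜ.toList.map (gen K))

section Independence

variable {K : Type*} [Field K]

/-- The homomorphism to the free associative algebra. -/
def toFreeAssociative (K X : Type*) [Field K] :
    FreeAssosymmetric K X →ₗ[K] MonoidAlgebra K (FreeMonoid X) :=
  lift (isAssosymmetric_of_ring _) fun x => MonoidAlgebra.of K _ (FreeMonoid.of x)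

theorem toFreeAssociative_leftNormed {X : Type*} {l : List X} (hl : l ≠ []) :
    toFreeAssociative K X (leftNormed (l.map (gen K))) =
      MonoidAlgebra.of K _ (FreeMonoid.ofList l) := by
  rw [toFreeAssociative, lift_leftNormed, leftNormed_eq_prod (by simpa using hl)]
  clear hl
  induction l with
  | nil => rfl
  | cons x l ih => rw [List.map_cons, List.prod_cons, ih, ← map_mul]; rfl

theorem toFreeAssociative_nestedProduct {X : Type*} (l m : List X) :
    toFreeAssociative K X (nestedProduct (l.map (gen K)) (m.map (gen K))) = 0 := by
  rw [toFreeAssociative, lift_nestedProduct, nestedProduct_eq_zero]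

theorem linearIndependent_toFreeAssociative {n : ℕ} (hn : 1 ≤ n) :
    LinearIndependent K (toFreeAssociative K (Fin n) ∘
      fun σ : Equiv.Perm (Fin n) => leftNormed (letters K σ)) := by
  have e (σ : Equiv.Perm (Fin n)) : toFreeAssociative K (Fin n) (leftNormed (letters K σ)) =
      MonoidAlgebra.of K _ (FreeMonoid.ofList (List.ofFn σ)) := by
    -- Here `1 ≤ n` matters: the empty `leftNormed` is `0`, whereas the empty word is `1`.
    rw [← toFreeAssociative_leftNormed (by simpa using Nat.one_le_iff_ne_zero.1 hn), letters,
      List.map_ofFn]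
    rfl
  have hi : Function.Injective
      fun σ : Equiv.Perm (Fin n) => FreeMonoid.ofList (List.ofFn σ) :=
    fun σ τ h => DFunLike.coe_injective (List.ofFn_injective (FreeMonoid.ofList.injective h))
  simp only [Function.comp_def, e]
  exact (MonoidAlgebra.basis (FreeMonoid (Fin n)) K).linearIndependent.comp _ hi

/-- The homomorphism to the triple algebra over the polynomials, followed by the projection to the
third component. -/
def toPolynomial (K X : Type*) [Field K] :
    FreeAssosymmetric K X →ₗ[K] MvPolynomial (X ⊕ X) K :=
  TripleAlgebra.extraLinear K _ ∘ₗ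
    lift (TripleAlgebra.isAssosymmetric (MvPolynomial (X ⊕ X) K)) fun x =>
      -- Chosen so that `left` and `right - left` are independent variables: they record the outer
      -- and the inner letters.
      TripleAlgebra.mk (.X (.inl x)) (.X (.inl x) + .X (.inr x)) 0

theorem toPolynomial_nestedProduct {X : Type*} (l : List X) {m : List X} (hm : 3 ≤ m.length) :
    toPolynomial K X (nestedProduct (l.map (gen K)) (m.map (gen K))) =
      (l.map fun x => MvPolynomial.X (.inl x)).prod *
        (m.map fun x => MvPolynomial.X (.inr x)).prod := by
  rw [toPolynomial, LinearMap.comp_apply, lift_nestedProduct,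
    TripleAlgebra.nestedProduct_eq _ (by simpa using hm), List.map_map, List.map_map]
  simp only [TripleAlgebra.extraLinear_mk, Function.comp_def, TripleAlgebra.mk_left,
    TripleAlgebra.mk_right,
    add_sub_cancel_left]

theorem linearIndependent_toPolynomial (n : ℕ) :
    LinearIndependent K (toPolynomial K (Fin n) ∘
      fun s : {s : Finset (Fin n) // 3 ≤ sᶜ.card} => subsetElement K s.1) := by
  let d (s : Finset (Fin n)) : Fin n ⊕ Fin n →₀ ℕ :=
    ∑ i ∈ s, Finsupp.single (.inl i) 1 + ∑ i ∈ sᶜ, Finsupp.single (.inr i) 1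
  have e (s : {s : Finset (Fin n) // 3 ≤ sᶜ.card}) :
      toPolynomial K (Fin n) (subsetElement K s.1) = MvPolynomial.monomial (d s.1) 1 := by
    rw [subsetElement, toPolynomial_nestedProduct _ (by simpa using s.2), Finset.prod_map_toList,
      Finset.prod_map_toList]
    simp only [d, MvPolynomial.X, ← MvPolynomial.monomial_sum_one, MvPolynomial.monomial_mul,
      mul_one]
  have hd : Function.Injective d := fun s t h => by
    ext i
    have h1 (s : Finset (Fin n)) : d s (.inl i) = if i ∈ s then 1 else 0 := by
      simp [d, Finsupp.single_apply]
    have := DFunLike.congr_fun h (.inl i)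
    rw [h1, h1] at this
    split_ifs at this <;> simp_all
  simp only [Function.comp_def, e]
  have := (MvPolynomial.basisMonomials (Fin n ⊕ Fin n) K).linearIndependent.comp _
    (hd.comp Subtype.val_injective : Function.Injective
      (d ∘ fun s : {s : Finset (Fin n) // 3 ≤ sᶜ.card} => s.1))
  simpa [Function.comp_def] using this

/-- The family of all basis elements of both types. -/
def basisFamily (K : Type*) [Field K] (n : ℕ) :
    Equiv.Perm (Fin n) ⊕ {s : Finset (Fin n) // 3 ≤ sᶜ.card} → FreeAssosymmetric K (Fin n) :=
  Sum.elim (fun σ => leftNormed (letters K σ)) fun s => subsetElement K s.1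

/-- The associative model is injective on the span of the first type and zero on the second, so the
two spans are disjoint; the polynomial model is needed only within the second type. -/
theorem linearIndependent_basisFamily {n : ℕ} (hn : 1 ≤ n) :
    LinearIndependent K (basisFamily K n) := by
  refine (LinearIndependent.of_comp _ (linearIndependent_toFreeAssociative hn)).sum_type
    (LinearIndependent.of_comp _ (linearIndependent_toPolynomial n)) ?_
  refine (Submodule.range_ker_disjoint (linearIndependent_toFreeAssociative hn)).mono_right ?_
  rw [Submodule.span_le]
  rintro _ ⟨s, rfl⟩
  exact toFreeAssociative_nestedProduct _ _

end Independence

/-! ### Multihomogeneity of both types. -/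

section Span

variable {K : Type*} [Field K]

/-- The span of the monomials of multidegree `μ`. -/
def monomialSpan (K : Type*) {X : Type*} [Field K] (μ : Multiset X) :
    Submodule K (FreeAssosymmetric K X) :=
  Submodule.span K (monomial K '' {w | multidegree w = μ})

variable {X : Type*}

theorem mul_mem_monomialSpan {μ ν : Multiset X} {u v : FreeAssosymmetric K X}
    (hu : u ∈ monomialSpan K μ) (hv : v ∈ monomialSpan K ν) : u * v ∈ monomialSpan K (μ + ν) := by
  induction hu using Submodule.span_induction with
  | mem u hu =>
    obtain ⟨w, rfl, rfl⟩ := hu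
    induction hv using Submodule.span_induction with
    | mem v hv =>
      obtain ⟨w', rfl, rfl⟩ := hv
      exact Submodule.subset_span ⟨w * w', rfl, monomial_mul w w'⟩
    | zero => rw [mul_zero]; exact zero_mem _
    | add u v _ _ hu hv => rw [mul_add]; exact add_mem hu hv
    | smul c u _ hu => rw [mul_smul_comm]; exact Submodule.smul_mem _ c hu
  | zero => rw [zero_mul]; exact zero_mem _
  | add u v _ _ hu hv => rw [add_mul]; exact add_mem hu hv
  | smul c u _ hu => rw [smul_mul_assoc]; exact Submodule.smul_mem _ c hu

theorem gen_mem_monomialSpan (x : X) : gen K x ∈ monomialSpan K {x} :=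
  Submodule.subset_span ⟨FreeMagma.of x, rfl, rfl⟩

theorem leftNormed_mem_monomialSpan (l : List X) :
    leftNormed (l.map (gen K)) ∈ monomialSpan K (l : Multiset X) := by
  induction l using List.reverseRecOn with
  | nil => exact zero_mem _
  | append_singleton l x ih =>
    rcases eq_or_ne l [] with rfl | hl
    · exact gen_mem_monomialSpan x
    · rw [List.map_append, List.map_singleton, leftNormed_append (by simpa using hl),
        ← Multiset.coe_add]
      exact mul_mem_monomialSpan ih (gen_mem_monomialSpan x)

theorem commutatorOfAssociator_mem_monomialSpan (m : List X) :
    commutatorOfAssociator (m.map (gen K)) ∈ monomialSpan K (m : Multiset X) := by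
  induction m using List.reverseRecOn with
  | nil => exact zero_mem _
  | append_singleton l t ih =>
    rcases le_or_gt 3 l.length with hl | hl
    · rw [List.map_append, List.map_singleton, commutatorOfAssociator_append (by simpa using hl),
        ← Multiset.coe_add]
      refine sub_mem (mul_mem_monomialSpan ih (gen_mem_monomialSpan t)) ?_
      rw [add_comm]
      exact mul_mem_monomialSpan (gen_mem_monomialSpan t) ih
    · match l, hl with
      | [], _ | [_], _ =>
        rw [commutatorOfAssociator_of_length_lt (by simp)]
        exact zero_mem _
      | [x, y], _ =>
        have hx := gen_mem_monomialSpan (K := K) x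
        have hy := gen_mem_monomialSpan (K := K) y
        have ht := gen_mem_monomialSpan (K := K) t
        have h1 := mul_mem_monomialSpan (mul_mem_monomialSpan hx hy) ht
        have h2 := mul_mem_monomialSpan hx (mul_mem_monomialSpan hy ht)
        rw [← add_assoc] at h2
        exact sub_mem h1 h2

theorem nestedProduct_mem_monomialSpan (l m : List X) :
    nestedProduct (l.map (gen K)) (m.map (gen K)) ∈
      monomialSpan K ((l ++ m : List X) : Multiset X) := by
  induction l with
  | nil => exact commutatorOfAssociator_mem_monomialSpan m
  | cons x l ih =>
    rw [List.map_cons, nestedProduct_cons, List.cons_append, ← Multiset.cons_coe,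
      ← Multiset.singleton_add]
    exact mul_mem_monomialSpan (gen_mem_monomialSpan x) ih

end Span

/-! ### Decomposition of the multilinear part. -/

section Multilinear

variable {K : Type*} [Field K] {n : ℕ}

theorem letters_eq (σ : Equiv.Perm (Fin n)) :
    letters K σ = (List.ofFn σ).map (gen K) := by
  rw [letters, List.map_ofFn]
  rfl

theorem coe_ofFn_perm (σ : Equiv.Perm (Fin n)) :
    (List.ofFn σ : Multiset (Fin n)) = (Finset.univ : Finset (Fin n)).val := by
  rw [List.ofFn_eq_map, ← Multiset.map_coe]
  exact congrArg Finset.val (Finset.map_univ_equiv σ)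

theorem exists_perm_of_coe_eq {l : List (Fin n)}
    (hl : (l : Multiset (Fin n)) = (Finset.univ : Finset (Fin n)).val) :
    ∃ σ : Equiv.Perm (Fin n), l = List.ofFn σ := by
  have hn : n = l.length := by simpa using (congrArg Multiset.card hl).symm
  have hnd : l.Nodup := by
    rw [← Multiset.coe_nodup, hl]
    exact Finset.nodup _
  have hmem (i : Fin n) : i ∈ l := by
    rw [← Multiset.mem_coe, hl]
    exact Finset.mem_univ i
  refine ⟨(finCongr hn).trans (hnd.getEquivOfForallMemList l hmem),
    List.ext_getElem (by simpa using hn.symm) fun i h1 h2 => ?_⟩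
  rw [List.getElem_ofFn]
  rfl

theorem KT_eq_firstSpan :
    KT K n = firstSpan K (Finset.univ : Finset (Fin n)).val := by
  refine congrArg (Submodule.span K) (Set.ext fun u => ⟨?_, ?_⟩)
  · rintro ⟨σ, rfl⟩
    exact ⟨List.ofFn σ, coe_ofFn_perm σ, by rw [letters_eq]⟩
  · rintro ⟨l, hl, rfl⟩
    obtain ⟨σ, rfl⟩ := exists_perm_of_coe_eq hl
    exact ⟨σ, by rw [letters_eq]⟩

theorem coe_toList_append_compl (s : Finset (Fin n)) :
    ((s.toList ++ sᶜ.toList : List (Fin n)) : Multiset (Fin n)) =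
      (Finset.univ : Finset (Fin n)).val := by
  rw [← Multiset.coe_add, Finset.coe_toList, Finset.coe_toList, ← Finset.disjUnion_val _ _
    disjoint_compl_right, Finset.disjUnion_eq_union, Finset.union_compl]

theorem KT_le_monomialSpan : KT K n ≤ monomialSpan K (Finset.univ : Finset (Fin n)).val := by
  rw [KT_eq_firstSpan, firstSpan, Submodule.span_le]
  rintro _ ⟨l, hl, rfl⟩
  rw [← hl]
  exact leftNormed_mem_monomialSpan l

theorem rename_mem_KT (σ : Equiv.Perm (Fin n)) {u : FreeAssosymmetric K (Fin n)}
    (hu : u ∈ KT K n) : rename K σ u ∈ KT K n := by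
  suffices KT K n ≤ (KT K n).comap (rename K σ) from this hu
  nth_rw 1 [KT]
  rw [Submodule.span_le]
  rintro _ ⟨τ, rfl⟩
  refine Submodule.subset_span ⟨σ * τ, ?_⟩
  rw [letters_eq, rename_leftNormed, letters_eq, List.map_ofFn]
  rfl

variable [CharZero K]

theorem nestedProduct_eq_subsetElement {l m : List (Fin n)}
    (h : ((l ++ m : List (Fin n)) : Multiset (Fin n)) = (Finset.univ : Finset (Fin n)).val) :
    nestedProduct (l.map (gen K)) (m.map (gen K)) = subsetElement K l.toFinset ∧
      l.toFinset.card = l.length ∧ l.length + m.length = n := by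
  have hnd : (l ++ m).Nodup := by
    rw [← Multiset.coe_nodup, h]
    exact Finset.nodup _
  have hmem (i : Fin n) : i ∈ l ++ m := by
    rw [← Multiset.mem_coe, h]
    exact Finset.mem_univ i
  obtain ⟨hl, hm, hd⟩ := List.nodup_append.1 hnd
  refine ⟨nestedProduct_perm (isAssosymmetric K (Fin n)) ?_ ?_, List.toFinset_card_of_nodup hl, ?_⟩
  · refine List.Perm.map _ ((List.perm_ext_iff_of_nodup hl (Finset.nodup_toList _)).2 fun i => ?_)
    simp
  · refine List.Perm.map _ ((List.perm_ext_iff_of_nodup hm (Finset.nodup_toList _)).2 fun i => ?_)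
    have := hmem i
    rw [List.mem_append] at this
    simp only [Finset.mem_toList, Finset.mem_compl, List.mem_toFinset]
    exact ⟨fun h1 h2 => hd i h2 i h1 rfl, fun h1 => this.resolve_left h1⟩
  · have := congrArg Multiset.card h
    simpa using this

/-- The order conditions merely select one permutation for each `k`-subset of outer letters, which
by symmetry determines the element. -/
theorem KTk_eq_span {k : ℕ} (hk : k ≤ n) :
    KTk K n k = Submodule.span K (subsetElement K '' {s : Finset (Fin n) | s.card = k}) := by
  refine congrArg (Submodule.span K) (Set.ext fun u => ⟨?_, ?_⟩)
  · rintro ⟨σ, -, -, rfl⟩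
    have h : (((List.ofFn σ).take k ++ (List.ofFn σ).drop k : List (Fin n)) : Multiset (Fin n)) =
        (Finset.univ : Finset (Fin n)).val := by
      rw [List.take_append_drop, coe_ofFn_perm]
    obtain ⟨e, hc, -⟩ := nestedProduct_eq_subsetElement (K := K) h
    refine ⟨_, by simpa [hk] using hc, e.symm.trans ?_⟩
    rw [letters_eq, ← List.map_take, ← List.map_drop, nestedProduct]
  · rintro ⟨s, hs, rfl⟩
    have hs : s.card = k := hs
    have h : ((s.sort ++ sᶜ.sort : List (Fin n)) : Multiset (Fin n)) =
        (Finset.univ : Finset (Fin n)).val := by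
      rw [← coe_toList_append_compl s]
      exact Multiset.coe_eq_coe.2 ((Finset.sort_perm_toList _ _).append
        (Finset.sort_perm_toList _ _))
    -- The permutation lists `s` increasingly, then its complement increasingly.
    obtain ⟨σ, hσ⟩ := exists_perm_of_coe_eq h
    have hval (i : Fin n) : σ i = (s.sort ++ sᶜ.sort)[(i : ℕ)]'(by simp [hσ]) := by
      simp [hσ]
    have hlen : s.sort.length = k := by rw [Finset.length_sort, hs]
    refine ⟨σ, fun i j hij hj => ?_, fun i j hi hij => ?_, ?_⟩
    · rw [hval, hval, List.getElem_append_left (by omega), List.getElem_append_left (by omega)]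
      exact s.sortedLT_sort.strictMono_get hij
    · rw [hval, hval, List.getElem_append_right (by omega), List.getElem_append_right (by omega)]
      refine sᶜ.sortedLT_sort.getElem_lt_getElem_of_lt ?_
      omega
    · rw [letters_eq, ← hσ, ← List.map_take, ← List.map_drop, List.take_left' hlen,
        List.drop_left' hlen]
      exact nestedProduct_perm (isAssosymmetric K (Fin n))
        ((Finset.sort_perm_toList _ _).map _).symm ((Finset.sort_perm_toList _ _).map _).symm

theorem KTk_le_monomialSpan {k : ℕ} (hk : k ≤ n) :
    KTk K n k ≤ monomialSpan K (Finset.univ : Finset (Fin n)).val := by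
  rw [KTk_eq_span hk, Submodule.span_le]
  rintro _ ⟨s, -, rfl⟩
  rw [← coe_toList_append_compl s]
  exact nestedProduct_mem_monomialSpan _ _

theorem secondSpan_le :
    secondSpan K (Finset.univ : Finset (Fin n)).val ≤ ⨆ k : Fin (n - 2), KTk K n k := by
  rw [secondSpan, Submodule.span_le]
  rintro _ ⟨l, m, hm, h, rfl⟩
  obtain ⟨e, hc, hlen⟩ := nestedProduct_eq_subsetElement (K := K) h
  rw [e]
  -- At least three inner letters means `k ≤ n - 3`, that is, `k` lies in `Fin (n - 2)`.
  refine Submodule.mem_iSup_of_mem (⟨l.length, by omega⟩ : Fin (n - 2)) ?_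
  rw [KTk_eq_span (by dsimp only; omega)]
  exact Submodule.subset_span ⟨_, hc, rfl⟩

theorem KT_sup_iSup_KTk : KT K n ⊔ ⨆ k : Fin (n - 2), KTk K n k =
    monomialSpan K (Finset.univ : Finset (Fin n)).val := by
  refine le_antisymm (sup_le KT_le_monomialSpan (iSup_le fun k => KTk_le_monomialSpan (by omega)))
    ?_
  rw [monomialSpan, Submodule.span_le]
  rintro _ ⟨w, hw, rfl⟩
  rw [Set.mem_ofPred_eq] at hw
  have := monomial_mem (K := K) w
  rw [hw, ← KT_eq_firstSpan] at this
  exact SetLike.le_def.1 (sup_le_sup_left secondSpan_le _) this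

/-- The sets `S o` are disjoint blocks of indices of an independent family: all permutations, and
the subsets of each given size. -/
theorem iSupIndep_KT_KTk (hn : 1 ≤ n) : iSupIndep fun o : Option (Fin (n - 2)) =>
    o.elim (KT K n) fun k => KTk K n k := by
  let S : Option (Fin (n - 2)) → Set (Equiv.Perm (Fin n) ⊕ {s : Finset (Fin n) // 3 ≤ sᶜ.card}) :=
    fun o => o.elim (Set.range Sum.inl) fun k => Sum.inr '' {s | s.1.card = k}
  have hS (o : Option (Fin (n - 2))) : (o.elim (KT K n) fun k => KTk K n k) =
      Submodule.span K (basisFamily K n '' S o) := by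
    cases o with
    | none =>
      refine congrArg (Submodule.span K) (Set.ext fun u => ⟨?_, ?_⟩)
      · rintro ⟨σ, rfl⟩
        exact ⟨Sum.inl σ, ⟨σ, rfl⟩, rfl⟩
      · rintro ⟨_, ⟨σ, rfl⟩, rfl⟩
        exact ⟨σ, rfl⟩
    | some k =>
      refine (KTk_eq_span (by omega)).trans (congrArg (Submodule.span K) (Set.ext fun u => ⟨?_,
        ?_⟩))
      · rintro ⟨s, hs, rfl⟩
        have hs : s.card = k := hs
        refine ⟨Sum.inr ⟨s, ?_⟩, ⟨_, hs, rfl⟩, rfl⟩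
        rw [Finset.card_compl, Fintype.card_fin]
        omega
      · rintro ⟨_, ⟨s, hs, rfl⟩, rfl⟩
        exact ⟨s.1, hs, rfl⟩
  have hd : Pairwise (Function.onFun Disjoint S) := by
    intro o o' ho
    rw [Function.onFun, Set.disjoint_left]
    rintro x hx hx'
    match o, o' with
    | none, none => exact ho rfl
    | none, some k =>
      obtain ⟨σ, rfl⟩ := hx
      obtain ⟨s, -, h⟩ := hx'
      cases h
    | some k, none =>
      obtain ⟨σ, rfl⟩ := hx'
      obtain ⟨s, -, h⟩ := hx
      cases h
    | some k, some k' =>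
      obtain ⟨s, hs, rfl⟩ := hx
      obtain ⟨s', hs', h⟩ := hx'
      cases h
      exact ho (congrArg some (Fin.ext (hs.symm.trans hs')))
  intro o
  simp only [hS]
  rw [← Submodule.span_iUnion₂]
  rw [← Set.image_iUnion₂]
  refine (linearIndependent_basisFamily hn).disjoint_span_image ?_
  simp only [Set.disjoint_iUnion_right]
  exact fun o' h => hd h.symm

theorem rename_mem_KTk (σ : Equiv.Perm (Fin n)) {k : ℕ} (hk : k ≤ n)
    {u : FreeAssosymmetric K (Fin n)}
    (hu : u ∈ KTk K n k) : rename K σ u ∈ KTk K n k := by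
  suffices KTk K n k ≤ (KTk K n k).comap (rename K σ) from this hu
  rw [KTk_eq_span hk, Submodule.span_le]
  rintro _ ⟨s, hs, rfl⟩
  have hs : s.card = k := hs
  have h : ((s.toList.map σ ++ sᶜ.toList.map σ : List (Fin n)) : Multiset (Fin n)) =
      (Finset.univ : Finset (Fin n)).val := by
    rw [← List.map_append, ← Multiset.map_coe, coe_toList_append_compl]
    exact congrArg Finset.val (Finset.map_univ_equiv σ)
  obtain ⟨e, hc, -⟩ := nestedProduct_eq_subsetElement (K := K) h
  rw [SetLike.mem_coe, Submodule.mem_comap, subsetElement, rename_nestedProduct, e]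
  exact Submodule.subset_span ⟨_, by simpa [hs] using hc, rfl⟩

end Multilinear

/-! ### From internal to external direct sums of representations. -/

section Representation

open Representation

variable {K G V ι : Type*} [Field K] [Monoid G] [AddCommGroup V] [Module K V] {ρ : Representation K
  G V}

/-- A subrepresentation that is the internal direct sum of `A` and a family `B` is isomorphic to
their external direct sum. -/
theorem nonempty_equiv_of_iSupIndep [DecidableEq ι] (P A : Subrepresentation ρ)
    (B : ι → Subrepresentation ρ)
    (hi : iSupIndep fun o : Option ι => o.elim A.toSubmodule fun k => (B k).toSubmodule)
    (hs : A.toSubmodule ⊔ ⨆ k, (B k).toSubmodule = P.toSubmodule) :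
    Nonempty (P.toRepresentation.Equiv
      (A.toRepresentation.prod (Representation.directSum fun k => (B k).toRepresentation))) := by
  have hB : iSupIndep fun k => (B k).toSubmodule :=
    hi.comp (f := some) (Option.some_injective ι)
  have hAB : Disjoint A.toSubmodule (⨆ k, (B k).toSubmodule) := by
    refine (hi none).mono_right (iSup_le fun k => ?_)
    exact le_iSup₂_of_le (some k) (by simp) le_rfl
  let g := DirectSum.coeLinearMap fun k => (B k).toSubmodule
  -- The summation map: its injectivity is independence, its range is `P`, and equivariance can be
  -- tested on each summand.
  let f := LinearMap.coprod A.toSubmodule.subtype g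
  have hg : LinearMap.ker g = ⊥ := LinearMap.ker_eq_bot.2 hB.dfinsupp_lsum_injective
  have hgr : LinearMap.range g = ⨆ k, (B k).toSubmodule := DirectSum.range_coeLinearMap
  have hf : Function.Injective f := by
    rw [← LinearMap.ker_eq_bot, LinearMap.ker_coprod_of_disjoint_range, Submodule.ker_subtype, hg,
      Submodule.prod_bot]
    rwa [Submodule.range_subtype, hgr]
  have hfr : LinearMap.range f = P.toSubmodule := by
    rw [LinearMap.range_coprod, Submodule.range_subtype, hgr, hs]
  let e := (LinearEquiv.ofInjective f hf).trans (LinearEquiv.ofEq _ _ hfr)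
  have he (x) : (e x : V) = f x := rfl
  let τ := A.toRepresentation.prod (Representation.directSum fun k => (B k).toRepresentation)
  have hfτ (s : G) : f ∘ₗ τ s = ρ s ∘ₗ f := by
    refine LinearMap.prod_ext (LinearMap.ext fun a => ?_)
      (DirectSum.linearMap_ext _ fun k => LinearMap.ext fun b => ?_)
    · simp [f, τ, Subrepresentation.toRepresentation]
    · simp [f, g, τ, Subrepresentation.toRepresentation, DirectSum.coeLinearMap_lof]
  refine ⟨Representation.Equiv.mk e.symm fun s => LinearMap.ext fun v => ?_⟩
  obtain ⟨x, rfl⟩ := e.surjective v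
  refine e.injective (Subtype.ext ?_)
  simp only [LinearMap.comp_apply, LinearEquiv.coe_coe, LinearEquiv.symm_apply_apply,
    LinearEquiv.apply_symm_apply, he]
  exact (LinearMap.congr_fun (hfτ s) x).symm

end Representation

end Assosymmetric

end

theorem corollary2p3 (K : Type*) [Field K] [IsAlgClosed K] [CharZero K] (n : ℕ) (hn : 1 ≤ n) :
    ∃ (A : Subrepresentation (Assosymmetric.variableAction K n))
      (B : Fin (n - 2) → Subrepresentation (Assosymmetric.variableAction K n)),
      A.toSubmodule = Assosymmetric.KT K n ∧
      (∀ k, (B k).toSubmodule = Assosymmetric.KTk K n k) ∧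
      iSupIndep (fun o : Option (Fin (n - 2)) =>
        o.elim A.toSubmodule fun k => (B k).toSubmodule) ∧
      A.toSubmodule ⊔ ⨆ k, (B k).toSubmodule =
        (Assosymmetric.multilinearPart K n).toSubmodule ∧
      Nonempty ((Assosymmetric.multilinearPart K n).toRepresentation.Equiv
        (A.toRepresentation.prod
          (Representation.directSum fun k => (B k).toRepresentation))) := by
  have hi := Assosymmetric.iSupIndep_KT_KTk (K := K) hn
  -- The right-hand side `monomialSpan` is definitionally the submodule of `multilinearPart`.
  have hs := Assosymmetric.KT_sup_iSup_KTk (K := K) (n := n)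
  refine ⟨⟨_, fun σ _ hu => Assosymmetric.rename_mem_KT σ hu⟩,
    fun k => ⟨_, fun σ _ hu => Assosymmetric.rename_mem_KTk σ (by omega) hu⟩, rfl, fun _ => rfl,
    hi, hs, Assosymmetric.nonempty_equiv_of_iSupIndep _ _ _ hi hs⟩
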